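/- Let $\mu$ be a probability distribution on $(-\infty,+\infty]$ with $\mu(\{+\infty\})<1$, and let $\omega$ be a random variable with law $\mu$. Assume that for all $\gamma\in(0,\infty)$ $$\psi(\gamma):=\log \mathbb{E}\, e^{-\gamma\omega}<\infty$$ (with $e^{-\infty}=0$). For each $n$ let $E_n$ be the edge set of the complete bipartite graph $K_{n,n}$, let $\boldsymbol\omega=(\omega_e)_{e\in E_n}$ be i.i.d. random variables with law $\mu$, and let $\mathcal{M}_n$ be the set of all perfect matchings of $K_{n,n}$. For $\pi\in\mathcal{M}_n$ put $W(\pi)=\sum_{e\in\pi}\omega_e$, and for $\beta\in(0,\infty)$ define the partition function $$Z_n(\beta,\boldsymbol\omega)=\frac1{n!}\sum_{\pi\in\mathcal{M}_n}\exp(-\beta W(\pi)).$$ Let $$v_\beta^2:=\mathbb{E}\,e^{-2\beta\omega-2\psi(\beta)}-1=e^{\psi(2\beta)-2\psi(\beta)}-1 .$$ Then for every fixed $\beta\in(0,\infty)$, as $n\to\infty$, $$\log Z_n(\beta,\boldsymbol\omega)-n\psi(\beta)\;\Longrightarrow\; N\!\left(-\frac{v_\beta^2}{2},\,v_\beta^2\right)$$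 in distribution, as random variables with values in $[-\infty,+\infty]$ (with $\log 0=-\infty$), where $N(0,0)$ is the point mass at $0$. -/

import Mathlib

open MeasureTheory ProbabilityTheory Filter
open scoped NNReal ENNReal

noncomputable section

namespace MinMatching

/-- The complete bipartite graph `K_{n,n}`. -/
abbrev K (n : ℕ) : SimpleGraph (Fin n ⊕ Fin n) := completeBipartiteGraph (Fin n) (Fin n)

/-- The set of edges of `K_{n,n}`. -/
abbrev Edge (n : ℕ) : Type := (K n).edgeSet

instance (n : ℕ) : Fintype (Edge n) := Fintype.ofFinite _

/-- The type of perfect matchings of `K_{n,n}`. -/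
abbrev PerfectMatching (n : ℕ) : Type := {M : (K n).Subgraph // M.IsPerfectMatching}

instance (n : ℕ) : Fintype (PerfectMatching n) := Fintype.ofFinite _

open scoped Classical in
/-- The total weight `W(π) = ∑_{e ∈ π} w e` of a perfect matching `π`. Weights are extended reals,
since a weight may be `+∞`. (The value `-∞` has probability zero as soon as the Laplace transform
is finite.) -/
def weight {n : ℕ} (w : Edge n → EReal) (M : PerfectMatching n) : EReal :=
  ∑ e : Edge n, if e.1 ∈ M.1.edgeSet then w e else 0

/-- The partition function `Z(β, w) = (1 / n!) ∑_π exp (-β W(π))`, the sum being over all perfect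
matchings of `K_{n,n}`; here `exp (-∞) = 0`. -/
def partitionFunction (n : ℕ) (β : ℝ) (w : Edge n → EReal) : ℝ≥0∞ :=
  (n.factorial : ℝ≥0∞)⁻¹ * ∑ M : PerfectMatching n, EReal.exp (((-β : ℝ) : EReal) * weight w M)

/-- `ψ(β) = log E exp (-β ω)`, for `ω` of law `μ`, as an extended real. -/
def psi (μ : Measure EReal) (β : ℝ) : EReal :=
  ENNReal.log (∫⁻ x, EReal.exp (((-β : ℝ) : EReal) * x) ∂μ)

/-- `v_β ^ 2 = E exp (-2 β ω - 2 ψ(β)) - 1`, for `ω` of law `μ`. -/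
def vSq (μ : Measure EReal) (β : ℝ) : ℝ :=
  (∫⁻ x, EReal.exp (((-(2 * β) : ℝ) : EReal) * x - 2 * psi μ β) ∂μ).toReal - 1

end MinMatching

end

noncomputable section

namespace MinMatching

open scoped Topology

/-! Perfect matchings are permutations, so after dividing every weight `exp (-β ω)` by its mean,
`Z_n` over its expectation becomes the permanent over `n!` (`permMean`) of a matrix with independent
nonnegative entries `Y e` of mean one and variance `v = v_β²`.

This permanent is compared in L² with `entryProd`, the product of `1 + (Y e - 1) / n` over all `n²`
entries. Expand both in products of `Y e - 1` over sets of `k` entries: the permanent gives weight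
`(n - k)! / n!`, about `n ^ (-k)`, to partial matchings, and the product gives `n ^ (-k)` to every
set, the other sets being negligible. The proof needs only three moments: both second moments are at
most `exp v`, and the mixed moment is `(1 + v / n) ^ n → exp v`, so the squared distance tends to
zero (`integral_permMean_sub_entryProd_sq`).

The logarithm of `entryProd` is a sum of `n²` i.i.d. terms, each with mean about `-v / (2n²)` and
variance about `v / n²`; characteristic functions give the limit `N(-v/2, v)`
(`tendstoInDistribution_sum_log`). The L² comparison transfers it, after exponentiating, to the
permanent, and the logarithm is taken at the end. -/

/-! ### Coincidences of permutations -/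

/-- The number of permutations fixing every point of `S`. -/
lemma card_perm_fixing {n : ℕ} (S : Finset (Fin n)) :
    (Finset.univ.filter fun σ : Equiv.Perm (Fin n) ↦ ∀ i ∈ S, σ i = i).card
      = (n - S.card).factorial := by
  classical
  have e := Equiv.Perm.subtypeEquivSubtypePerm (fun i : Fin n ↦ i ∉ S)
  have h := Fintype.card_congr e
  rw [Fintype.card_perm, Fintype.card_subtype] at h
  simp only [not_not] at h
  rw [Fintype.card_subtype] at h
  rw [← h]
  congr 1
  have : (Finset.univ.filter fun i : Fin n ↦ i ∉ S) = Sᶜ := by ext; simp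
  rw [this, Finset.card_compl, Fintype.card_fin]

/-- Expanding the product over sets `S` of fixed points, each `S` of size `k` counts `(n - k)!`
permutations; since `choose n k * (n - k)! = n! / k!`, a truncated exponential series appears. -/
lemma sum_perm_prod_fixed_le (n : ℕ) {v : ℝ} (hv : 0 ≤ v) :
    ∑ σ : Equiv.Perm (Fin n), ∏ i, (1 + if σ i = i then v else 0)
      ≤ n.factorial * Real.exp v := by
  classical
  have h1 : ∀ σ : Equiv.Perm (Fin n), ∏ i, (1 + if σ i = i then v else 0)
      = ∑ S : Finset (Fin n), if ∀ i ∈ S, σ i = i then v ^ S.card else 0 := by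
    intro σ
    rw [Finset.prod_one_add, Finset.powerset_univ]
    refine Finset.sum_congr rfl fun S _ ↦ ?_
    split_ifs with h
    · rw [Finset.prod_congr rfl (fun i hi ↦ if_pos (h i hi)), Finset.prod_const]
    · push Not at h
      obtain ⟨i, hi, hne⟩ := h
      exact Finset.prod_eq_zero hi (if_neg hne)
  simp_rw [h1]
  rw [Finset.sum_comm]
  have h2 : ∀ S : Finset (Fin n),
      (∑ σ : Equiv.Perm (Fin n), if ∀ i ∈ S, σ i = i then v ^ S.card else 0)
        = (n - S.card).factorial * v ^ S.card := by
    intro S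
    rw [← Finset.sum_filter, Finset.sum_const, card_perm_fixing, nsmul_eq_mul]
  simp_rw [h2]
  rw [← Finset.powerset_univ,
    Finset.sum_powerset_apply_card (fun k ↦ ((n - k).factorial : ℝ) * v ^ k),
    Finset.card_univ, Fintype.card_fin]
  calc ∑ m ∈ Finset.range (n + 1), n.choose m • (((n - m).factorial : ℝ) * v ^ m)
      = ∑ m ∈ Finset.range (n + 1), (n.factorial : ℝ) * (v ^ m / m.factorial) := by
        refine Finset.sum_congr rfl fun m hm ↦ ?_
        have hm' : m ≤ n := Nat.lt_succ_iff.1 (Finset.mem_range.1 hm)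
        rw [← Nat.choose_mul_factorial_mul_factorial hm']
        have : (m.factorial : ℝ) ≠ 0 := by positivity
        push_cast
        rw [nsmul_eq_mul]
        field_simp
    _ = n.factorial * ∑ m ∈ Finset.range (n + 1), v ^ m / m.factorial := by
        rw [Finset.mul_sum]
    _ ≤ _ := by
        gcongr
        exact Real.sum_le_exp_of_nonneg hv _

/-- Replacing `σ` by `τ * σ` turns coincidences of the pair into fixed points of one permutation. -/
lemma sum_perm_perm_prod_le (n : ℕ) {v : ℝ} (hv : 0 ≤ v) :
    ∑ σ : Equiv.Perm (Fin n), ∑ τ : Equiv.Perm (Fin n), ∏ i, (1 + if σ i = τ i then v else 0)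
      ≤ (n.factorial : ℝ) ^ 2 * Real.exp v := by
  have h : ∀ τ : Equiv.Perm (Fin n),
      ∑ σ : Equiv.Perm (Fin n), ∏ i, (1 + if σ i = τ i then v else 0)
        = ∑ σ : Equiv.Perm (Fin n), ∏ i, (1 + if σ i = i then v else 0) := by
    intro τ
    rw [← Equiv.sum_comp (Equiv.mulLeft τ)]
    simp
  rw [Finset.sum_comm]
  simp_rw [h]
  rw [Finset.sum_const, Finset.card_univ, Fintype.card_perm, Fintype.card_fin, nsmul_eq_mul, sq,
    mul_assoc]
  gcongr
  exact sum_perm_prod_fixed_le n hv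

/-! ### Second-order expansion of the characteristic function of one log term -/

open Complex in
/-- The second-order Taylor remainder of `exp (i s)`. -/
lemma norm_cexp_sub_one_sub_le (s : ℝ) : ‖cexp (s * I) - 1 - s * I‖ ≤ 3 * s ^ 2 := by
  have hn : ‖(s * I : ℂ)‖ = |s| := by simp
  by_cases hs : |s| ≤ 1
  · have h := Complex.norm_exp_sub_sum_le_norm_mul_exp (s * I) 2
    simp only [Finset.sum_range_succ, Finset.sum_range_zero, hn, sq_abs] at h
    have h2 : Real.exp |s| ≤ 3 :=
      (Real.exp_le_exp.2 hs).trans (by have := Real.exp_one_lt_d9; linarith)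
    calc _ ≤ s ^ 2 * Real.exp |s| := by
            convert h using 2; simp; ring
      _ ≤ _ := by nlinarith [sq_nonneg s]
  · push Not at hs
    have h1 : ‖cexp (s * I) - 1‖ ≤ |s| := by
      simpa [mul_comm] using Real.norm_exp_I_mul_ofReal_sub_one_le (x := s)
    calc _ ≤ ‖cexp (s * I) - 1‖ + ‖(s * I : ℂ)‖ := norm_sub_le _ _
      _ ≤ |s| + |s| := by rw [hn]; gcongr
      _ ≤ _ := by nlinarith [sq_abs s]

lemma log_one_add_bounds {u : ℝ} (hu : -(1 / 2) ≤ u) :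
    |Real.log (1 + u) - u| ≤ 2 * u ^ 2 ∧ |Real.log (1 + u)| ≤ 2 * |u| := by
  have hp : 0 < 1 + u := by linarith
  have h1 := Real.log_le_sub_one_of_pos hp
  have h2 := Real.one_sub_inv_le_log_of_pos hp
  have h3 : u - (1 - (1 + u)⁻¹) = u ^ 2 * (1 + u)⁻¹ := by field_simp; ring
  have h5 : (1 + u)⁻¹ ≤ 2 := by
    rw [inv_le_comm₀ hp (by norm_num)]; linarith
  have h4 : 1 - (1 + u)⁻¹ = u * (1 + u)⁻¹ := by field_simp; ring
  have h6 : 0 ≤ (1 + u)⁻¹ := by positivity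
  constructor
  · rw [abs_le]; constructor <;> nlinarith [sq_nonneg u]
  · rw [abs_le]
    constructor
    · rcases le_or_gt 0 u with h | h
      · rw [abs_of_nonneg h]; nlinarith
      · rw [abs_of_neg h]; nlinarith
    · have := le_abs_self u
      have := abs_nonneg u
      linarith

open Complex in
/-- The second-order Taylor remainder of `(1 + u) ^ (i t)`. -/
def powRemainder (t u : ℝ) : ℂ := cexp ((t * Real.log (1 + u) : ℝ) * I) - 1 - (t * u : ℝ) * I

open Complex in
-- The domination bound: it must hold for large `u` too and be only quadratic, since entries have
-- just two moments.
lemma norm_powRemainder_le (t : ℝ) {u : ℝ} (hu : -(1 / 2) ≤ u) :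
    ‖powRemainder t u‖ ≤ (12 * t ^ 2 + 2 * |t|) * u ^ 2 := by
  obtain ⟨h1, h2⟩ := log_one_add_bounds hu
  have h3 := norm_cexp_sub_one_sub_le (t * Real.log (1 + u))
  have e : powRemainder t u = (cexp ((t * Real.log (1 + u) : ℝ) * I) - 1
      - (t * Real.log (1 + u) : ℝ) * I) + ((t * (Real.log (1 + u) - u) : ℝ) : ℂ) * I := by
    rw [powRemainder]; push_cast; ring
  have h4 : ‖((t * (Real.log (1 + u) - u) : ℝ) : ℂ) * I‖ ≤ |t| * (2 * u ^ 2) := by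
    rw [norm_mul, norm_I, mul_one, Complex.norm_real, Real.norm_eq_abs, abs_mul]
    gcongr
  have h5 : Real.log (1 + u) ^ 2 ≤ 4 * u ^ 2 := by
    rw [← sq_abs (Real.log _), ← sq_abs u]
    nlinarith [abs_nonneg u, abs_nonneg (Real.log (1 + u))]
  rw [e]
  refine (norm_add_le _ _).trans ?_
  rw [mul_pow] at h3
  nlinarith [sq_nonneg t]

open Complex in
-- The local cubic bound, which identifies the pointwise limit. Substituting `log (1 + u) ≈ u - u² /
-- 2` in `exp (i t log (1 + u))` leaves the quadratic terms `-t² u² / 2 - i t u² / 2`.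
lemma norm_powRemainder_sub_le (t : ℝ) {u : ℝ} (hu : |u| ≤ 1 / 2) :
    ‖powRemainder t u - ((-(t ^ 2 / 2) * u ^ 2 : ℝ) - (t / 2 * u ^ 2 : ℝ) * I)‖
      ≤ ((8 * |t| ^ 3 * Real.exp (2 * |t|)) + 2 * |t| + 3 * t ^ 2) * |u| ^ 3 := by
  obtain ⟨h1, h2⟩ := log_one_add_bounds (abs_le.1 hu).1
  set L := Real.log (1 + u) with hL
  have ha : ‖cexp ((t * L : ℝ) * I) - (1 + (t * L : ℝ) * I - ((t * L) ^ 2 / 2 : ℝ))‖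
      ≤ 8 * |t| ^ 3 * Real.exp (2 * |t|) * |u| ^ 3 := by
    have h := Complex.norm_exp_sub_sum_le_norm_mul_exp ((t * L : ℝ) * I) 3
    have hn : ‖((t * L : ℝ) * I : ℂ)‖ = |t| * |L| := by
      rw [norm_mul, norm_I, mul_one, Complex.norm_real, Real.norm_eq_abs, abs_mul]
    rw [hn] at h
    have hs : ∑ m ∈ Finset.range 3, ((t * L : ℝ) * I : ℂ) ^ m / m.factorial
        = 1 + (t * L : ℝ) * I - ((t * L) ^ 2 / 2 : ℝ) := by
      simp [Finset.sum_range_succ, mul_pow, Nat.factorial]; ring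
    rw [hs] at h
    refine h.trans ?_
    have h6 : |t| * |L| ≤ 2 * |t| := by nlinarith [abs_nonneg t]
    calc (|t| * |L|) ^ 3 * Real.exp (|t| * |L|)
        ≤ (|t| * (2 * |u|)) ^ 3 * Real.exp (2 * |t|) := by gcongr
      _ = _ := by ring
  have hb : |L - u + u ^ 2 / 2| ≤ 2 * |u| ^ 3 := by
    have h := Real.abs_log_sub_add_sum_range_le (x := -u) (by rw [abs_neg]; linarith) 2
    simp only [Finset.sum_range_succ, Finset.sum_range_zero, abs_neg, sub_neg_eq_add] at h
    have h7 : |u| ^ (2 + 1) / (1 - |u|) ≤ 2 * |u| ^ 3 := by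
      rw [div_le_iff₀ (by linarith)]
      have := mul_nonneg (pow_nonneg (abs_nonneg u) 3) (by linarith : 0 ≤ 1 - 2 * |u|)
      rw [show 2 + 1 = 3 from rfl]
      linarith
    refine le_trans (le_of_eq ?_) (h.trans h7)
    congr 1
    push_cast
    ring
  have hc : |L ^ 2 - u ^ 2| ≤ 6 * |u| ^ 3 := by
    have : L ^ 2 - u ^ 2 = (L - u) * (L + u) := by ring
    rw [this, abs_mul]
    have h8 : |L + u| ≤ 3 * |u| := (abs_add_le _ _).trans (by linarith)
    calc |L - u| * |L + u| ≤ (2 * u ^ 2) * (3 * |u|) := by gcongr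
      _ = _ := by rw [← sq_abs u]; ring
  have e : powRemainder t u - ((-(t ^ 2 / 2) * u ^ 2 : ℝ) - (t / 2 * u ^ 2 : ℝ) * I)
      = (cexp ((t * L : ℝ) * I) - (1 + (t * L : ℝ) * I - ((t * L) ^ 2 / 2 : ℝ)))
        + ((t * (L - u + u ^ 2 / 2) : ℝ) : ℂ) * I + ((-(t ^ 2 / 2) * (L ^ 2 - u ^ 2) : ℝ) : ℂ) := by
    rw [powRemainder, ← hL]; push_cast; ring
  rw [e]
  refine (norm_add_le _ _).trans ?_
  refine (add_le_add_left (norm_add_le _ _) _).trans ?_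
  have hd : ‖((t * (L - u + u ^ 2 / 2) : ℝ) : ℂ) * I‖ ≤ |t| * (2 * |u| ^ 3) := by
    rw [norm_mul, norm_I, mul_one, Complex.norm_real, Real.norm_eq_abs, abs_mul]
    gcongr
  have he : ‖((-(t ^ 2 / 2) * (L ^ 2 - u ^ 2) : ℝ) : ℂ)‖ ≤ t ^ 2 / 2 * (6 * |u| ^ 3) := by
    rw [Complex.norm_real, Real.norm_eq_abs, abs_mul, abs_neg, abs_of_nonneg (by positivity)]
    gcongr
  linarith

open Complex in
lemma tendsto_sq_mul_powRemainder (t y : ℝ) :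
    Tendsto (fun n : ℕ ↦ (n : ℂ) ^ 2 * powRemainder t (y / n)) atTop
      (𝓝 ((-(t ^ 2 / 2) * y ^ 2 : ℝ) - (t / 2 * y ^ 2 : ℝ) * I)) := by
  rw [tendsto_iff_norm_sub_tendsto_zero]
  set C := (8 * |t| ^ 3 * Real.exp (2 * |t|)) + 2 * |t| + 3 * t ^ 2
  have hlim : Tendsto (fun n : ℕ ↦ C * |y| ^ 3 / (n : ℝ)) atTop (𝓝 0) :=
    tendsto_const_div_atTop_nhds_zero_nat _
  have hsmall : Tendsto (fun n : ℕ ↦ |y| / (n : ℝ)) atTop (𝓝 0) :=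
    tendsto_const_div_atTop_nhds_zero_nat _
  refine squeeze_zero' (Eventually.of_forall fun _ ↦ norm_nonneg _) ?_ hlim
  filter_upwards [eventually_ge_atTop 1, hsmall.eventually_le_const (by norm_num : (0 : ℝ) < 1 / 2)]
    with n hn hs
  have hn' : (0 : ℝ) < n := by exact_mod_cast hn
  have hnc : (n : ℂ) ≠ 0 := by exact_mod_cast hn'.ne'
  have hu : |y / n| ≤ 1 / 2 := by rwa [abs_div, Nat.abs_cast]
  have h := norm_powRemainder_sub_le t hu
  have e : (n : ℂ) ^ 2 * powRemainder t (y / n) - ((-(t ^ 2 / 2) * y ^ 2 : ℝ)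
      - (t / 2 * y ^ 2 : ℝ) * I) = (n : ℂ) ^ 2 * (powRemainder t (y / n)
        - ((-(t ^ 2 / 2) * (y / n) ^ 2 : ℝ) - (t / 2 * (y / n) ^ 2 : ℝ) * I)) := by
    push_cast; field_simp
  rw [e, norm_mul, norm_pow, Complex.norm_natCast]
  calc (n : ℝ) ^ 2 * _ ≤ (n : ℝ) ^ 2 * (C * |y / n| ^ 3) := by gcongr
    _ = _ := by rw [abs_div, Nat.abs_cast]; field_simp

open Complex in
/-- The characteristic function of a single term `log (1 + (x - 1) / n)`, to second order. -/
lemma tendsto_sq_mul_integral_sub_one {ν : Measure ℝ} [IsProbabilityMeasure ν]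
    (hnn : ∀ᵐ x ∂ν, 0 ≤ x) (hL2 : MemLp id 2 ν) (hmean : ∫ x, x ∂ν = 1) {v : ℝ}
    (hvar : ∫ x, (x - 1) ^ 2 ∂ν = v) (t : ℝ) :
    Tendsto (fun n : ℕ ↦ (n : ℂ) ^ 2 *
        (∫ x, cexp ((t * Real.log (1 + (x - 1) / n) : ℝ) * I) ∂ν - 1)) atTop
      (𝓝 (t * (-v / 2 : ℝ) * I - v * t ^ 2 / 2)) := by
  have hint : Integrable (fun x : ℝ ↦ x) ν := hL2.integrable one_le_two
  have hint1 : Integrable (fun x : ℝ ↦ x - 1) ν := hint.sub (integrable_const 1)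
  have hint2 : Integrable (fun x : ℝ ↦ (x - 1) ^ 2) ν :=
    (hL2.sub (memLp_const 1)).integrable_sq
  have hexp : ∀ n : ℕ, Integrable
      (fun x : ℝ ↦ cexp ((t * Real.log (1 + (x - 1) / n) : ℝ) * I)) ν := by
    intro n
    refine Integrable.of_bound (C := 1) (Measurable.aestronglyMeasurable (by fun_prop))
      (Eventually.of_forall fun x ↦ ?_)
    rw [Complex.norm_exp_ofReal_mul_I]
  have hrem : ∀ n : ℕ, ∫ x, (n : ℂ) ^ 2 * powRemainder t ((x - 1) / n) ∂ν
      = (n : ℂ) ^ 2 * (∫ x, cexp ((t * Real.log (1 + (x - 1) / n) : ℝ) * I) ∂ν - 1) := by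
    intro n
    rw [integral_const_mul]
    congr 1
    have hlin : Integrable (fun x : ℝ ↦ ((t * ((x - 1) / n) : ℝ) : ℂ) * I) ν :=
      (((hint1.div_const _).const_mul _).ofReal).mul_const _
    simp only [powRemainder]
    rw [integral_sub (f := fun x : ℝ ↦ cexp ((t * Real.log (1 + (x - 1) / n) : ℝ) * I) - 1)
      ((hexp n).sub (integrable_const _)) hlin, integral_sub (hexp n) (integrable_const _)]
    -- Mean one removes the linear term, which would otherwise be of order `n` after scaling by
    -- `n²`.
    have h0 : ∫ x, ((t * ((x - 1) / n) : ℝ) : ℂ) * I ∂ν = 0 := by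
      rw [integral_mul_const, integral_complex_ofReal, integral_const_mul, integral_div,
        integral_sub hint (integrable_const _), hmean]
      simp
    rw [h0]
    simp
  have hlim : ∫ x, (((-(t ^ 2 / 2) * (x - 1) ^ 2 : ℝ) : ℂ) - (t / 2 * (x - 1) ^ 2 : ℝ) * I) ∂ν
      = t * (-v / 2 : ℝ) * I - v * t ^ 2 / 2 := by
    rw [integral_sub ((hint2.const_mul _).ofReal) (((hint2.const_mul _).ofReal).mul_const _),
      integral_mul_const, integral_complex_ofReal, integral_complex_ofReal, integral_const_mul,
      integral_const_mul, hvar]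
    push_cast
    ring
  rw [← hlim]
  refine Tendsto.congr hrem ?_
  refine tendsto_integral_filter_of_dominated_convergence
    (fun x ↦ (12 * t ^ 2 + 2 * |t|) * (x - 1) ^ 2) (Eventually.of_forall fun n ↦ ?_) ?_
    (hint2.const_mul _) (Eventually.of_forall fun x ↦ tendsto_sq_mul_powRemainder t (x - 1))
  · unfold powRemainder
    exact Measurable.aestronglyMeasurable (by fun_prop)
  -- For `x ≥ 0` and `n ≥ 2`, `(x - 1) / n ≥ -1/2`, which keeps the logarithm away from its
  -- singularity.
  · filter_upwards [eventually_ge_atTop 2] with n hn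
    filter_upwards [hnn] with x hx
    have hn' : (2 : ℝ) ≤ n := by exact_mod_cast hn
    have hu : -(1 / 2) ≤ (x - 1) / n := by
      rw [le_div_iff₀ (by linarith)]; linarith
    rw [norm_mul, norm_pow, Complex.norm_natCast]
    calc (n : ℝ) ^ 2 * _ ≤ (n : ℝ) ^ 2 * ((12 * t ^ 2 + 2 * |t|) * ((x - 1) / n) ^ 2) := by
          gcongr; exact norm_powRemainder_le t hu
      _ = _ := by field_simp

/-- The power is `exp (n² log (1 + g))`, and `log (1 + g) - g = O(g²)` with `n² g² = (n² g) g → 0`.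
-/
lemma tendsto_one_add_pow_mul_self {g : ℕ → ℂ} {t : ℂ}
    (hg : Tendsto (fun n : ℕ ↦ (n : ℂ) ^ 2 * g n) atTop (𝓝 t)) :
    Tendsto (fun n ↦ (1 + g n) ^ (n * n)) atTop (𝓝 (Complex.exp t)) := by
  have hinv : Tendsto (fun n : ℕ ↦ ((n : ℂ) ^ 2)⁻¹) atTop (𝓝 0) := by
    have h : Tendsto (fun n : ℕ ↦ ((n : ℂ))⁻¹) atTop (𝓝 0) := tendsto_inv_atTop_nhds_zero_nat
    simpa using h.pow 2
  have hg0 : Tendsto g atTop (𝓝 0) := by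
    have h := hinv.mul hg
    rw [zero_mul] at h
    refine h.congr' ?_
    filter_upwards [eventually_ne_atTop 0] with n hn
    have : (n : ℂ) ≠ 0 := by exact_mod_cast hn
    field_simp
  have hO : (fun n : ℕ ↦ (n : ℂ) ^ 2 * (Complex.log (1 + g n) - g n))
      =O[atTop] fun n : ℕ ↦ ((n : ℂ) ^ 2 * g n) * g n := by
    have h := (Asymptotics.isBigO_refl (fun n : ℕ ↦ (n : ℂ) ^ 2) atTop).mul
      (Complex.log_sub_self_isBigO.comp_tendsto hg0)
    refine h.congr_right fun n ↦ ?_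
    simp only [Function.comp]
    ring
  have h0 : Tendsto (fun n : ℕ ↦ ((n : ℂ) ^ 2 * g n) * g n) atTop (𝓝 0) := by
    simpa using hg.mul hg0
  have hlog : Tendsto (fun n : ℕ ↦ (n : ℂ) ^ 2 * Complex.log (1 + g n)) atTop (𝓝 t) := by
    have h := (hO.trans_tendsto h0).add hg
    rw [zero_add] at h
    exact h.congr fun n ↦ by ring
  refine ((Complex.continuous_exp.tendsto _).comp hlog).congr' ?_
  filter_upwards [hg0.eventually_ne (show (0 : ℂ) ≠ -1 by simp)] with n hn
  have : 1 + g n ≠ 0 := fun h ↦ hn (eq_neg_of_add_eq_zero_right h)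
  simp only [Function.comp]
  rw [show (n : ℂ) ^ 2 = ((n * n : ℕ) : ℂ) by push_cast; ring, Complex.exp_nat_mul,
    Complex.exp_log this]

/-! ### Second moments of the permanent and of the entry product -/

/-- The permanent of a matrix, divided by `n!`. -/
def permMean (n : ℕ) (y : Fin n × Fin n → ℝ) : ℝ :=
  (n.factorial : ℝ)⁻¹ * ∑ σ : Equiv.Perm (Fin n), ∏ i, y (i, σ i)

/-- The product of `1 + (y e - 1) / n` over all entries `e`. -/
def entryProd (n : ℕ) (y : Fin n × Fin n → ℝ) : ℝ := ∏ e, (1 + (y e - 1) / n)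

lemma prod_perm_eq {n : ℕ} (σ : Equiv.Perm (Fin n)) (y : Fin n × Fin n → ℝ) :
    ∏ i, y (i, σ i) = ∏ e : Fin n × Fin n, if σ e.1 = e.2 then y e else 1 := by
  rw [Fintype.prod_prod_type]
  simp

@[fun_prop]
lemma measurable_permMean (n : ℕ) : Measurable (permMean n) := by unfold permMean; fun_prop

@[fun_prop]
lemma measurable_entryProd (n : ℕ) : Measurable (entryProd n) := by unfold entryProd; fun_prop

section Moments

variable {ν : Measure ℝ} [IsProbabilityMeasure ν] (hL2 : MemLp id 2 ν) (hmean : ∫ x, x ∂ν = 1)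
  {v : ℝ} (hvar : ∫ x, (x - 1) ^ 2 ∂ν = v)

include hL2 in
lemma integrable_quadratic (a b c : ℝ) : Integrable (fun x : ℝ ↦ a * x ^ 2 + b * x + c) ν :=
  ((hL2.integrable_sq.const_mul a).add ((hL2.integrable one_le_two).const_mul b)).add
    (integrable_const c)

include hL2 hmean hvar in
lemma integral_quadratic (a b c : ℝ) : ∫ x, (a * x ^ 2 + b * x + c) ∂ν = a * (1 + v) + b + c := by
  have h1 : Integrable (fun x : ℝ ↦ x) ν := hL2.integrable one_le_two
  have h2 : Integrable (fun x : ℝ ↦ x ^ 2) ν := hL2.integrable_sq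
  have h3 : ∫ x, x ^ 2 ∂ν = 1 + v := by
    have e : (fun x : ℝ ↦ x ^ 2) = fun x ↦ (x - 1) ^ 2 + (2 * x - 1) := by ext; ring
    rw [e, integral_add (f := fun x : ℝ ↦ (x - 1) ^ 2) (g := fun x ↦ 2 * x - 1) (hL2.sub (memLp_const 1)).integrable_sq
      ((h1.const_mul 2).sub (integrable_const 1)), hvar,
      integral_sub (h1.const_mul 2) (integrable_const 1), integral_const_mul, hmean]
    simp
    ring
  rw [integral_add (f := fun x : ℝ ↦ a * x ^ 2 + b * x) ((h2.const_mul a).add (h1.const_mul b)) (integrable_const c),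
    integral_add (h2.const_mul a) (h1.const_mul b), integral_const_mul, integral_const_mul, hmean,
    h3]
  simp

include hL2 hmean hvar in
/-- A product of quadratic polynomials in independent variables. -/
lemma integral_prod_quadratic {ι : Type*} [Fintype ι] {f : ι → ℝ → ℝ} (a b c : ι → ℝ)
    (hf : ∀ i x, f i x = a i * x ^ 2 + b i * x + c i) :
    Integrable (fun y : ι → ℝ ↦ ∏ i, f i (y i)) (Measure.pi fun _ ↦ ν) ∧
      ∫ y, ∏ i, f i (y i) ∂(Measure.pi fun _ : ι ↦ ν) = ∏ i, (a i * (1 + v) + b i + c i) := by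
  have hf' : f = fun i x ↦ a i * x ^ 2 + b i * x + c i := by ext; apply hf
  subst hf'
  refine ⟨Integrable.fintype_prod fun i ↦ integrable_quadratic hL2 _ _ _, ?_⟩
  rw [integral_fintype_prod_eq_prod (fun i x ↦ a i * x ^ 2 + b i * x + c i)]
  exact Finset.prod_congr rfl fun i _ ↦ integral_quadratic hL2 hmean hvar _ _ _

include hL2 hmean hvar in
lemma integral_entryProd_sq (n : ℕ) :
    Integrable (fun y ↦ entryProd n y ^ 2) (Measure.pi fun _ ↦ ν) ∧
      ∫ y, entryProd n y ^ 2 ∂(Measure.pi fun _ ↦ ν) ≤ Real.exp v := by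
  have hv : 0 ≤ v := hvar ▸ integral_nonneg fun _ ↦ sq_nonneg _
  obtain ⟨h1, h2⟩ := integral_prod_quadratic (ι := Fin n × Fin n) hL2 hmean hvar
    (f := fun _ x ↦ (1 + (x - 1) / n) ^ 2) (fun _ ↦ (1 / n : ℝ) ^ 2)
    (fun _ ↦ 2 * (1 / n : ℝ) * (1 - 1 / n)) (fun _ ↦ (1 - 1 / n : ℝ) ^ 2) (fun _ x ↦ by ring)
  simp only [entryProd, ← Finset.prod_pow]
  refine ⟨h1, h2.trans_le ?_⟩
  rw [Finset.prod_const, Finset.card_univ, Fintype.card_prod, Fintype.card_fin]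
  have e : (1 / n : ℝ) ^ 2 * (1 + v) + 2 * (1 / n : ℝ) * (1 - 1 / n) + (1 - 1 / n : ℝ) ^ 2
      = v * (1 / n) ^ 2 + 1 := by ring
  rw [e]
  calc (v * (1 / n : ℝ) ^ 2 + 1) ^ (n * n) ≤ Real.exp (v * (1 / n : ℝ) ^ 2) ^ (n * n) := by
        gcongr; exact Real.add_one_le_exp _
    _ = Real.exp ((n * n : ℕ) * (v * (1 / n : ℝ) ^ 2)) := (Real.exp_nat_mul _ _).symm
    _ ≤ Real.exp v := by
        gcongr
        rcases Nat.eq_zero_or_pos n with rfl | hn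
        · simpa using hv
        · have : (n : ℝ) ≠ 0 := by positivity
          apply le_of_eq
          push_cast
          field_simp

include hL2 hmean hvar in
lemma integral_permMean_mul_entryProd (n : ℕ) :
    Integrable (fun y ↦ permMean n y * entryProd n y) (Measure.pi fun _ ↦ ν) ∧
      ∫ y, permMean n y * entryProd n y ∂(Measure.pi fun _ ↦ ν) = (1 + v / n) ^ n := by
  -- An entry on the graph of `σ` contributes `x (1 + (x - 1) / n)`, of mean `1 + v / n`; any other
  -- entry contributes a factor of mean one.
  have key : ∀ σ : Equiv.Perm (Fin n), _ := fun σ ↦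
    integral_prod_quadratic (ι := Fin n × Fin n) hL2 hmean hvar
      (f := fun e x ↦ (if σ e.1 = e.2 then x else 1) * (1 + (x - 1) / n))
      (fun e ↦ if σ e.1 = e.2 then (1 / n : ℝ) else 0)
      (fun e ↦ if σ e.1 = e.2 then (1 - 1 / n : ℝ) else 1 / n)
      (fun e ↦ if σ e.1 = e.2 then 0 else (1 - 1 / n : ℝ))
      (fun e x ↦ by split_ifs <;> ring)
  have e : (fun y : Fin n × Fin n → ℝ ↦ permMean n y * entryProd n y) = fun y : Fin n × Fin n → ℝ ↦ (n.factorial : ℝ)⁻¹ *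
      ∑ σ : Equiv.Perm (Fin n), ∏ e : Fin n × Fin n,
        ((if σ e.1 = e.2 then y e else 1) * (1 + (y e - 1) / n)) := by
    ext y
    simp only [permMean, entryProd, prod_perm_eq, Finset.prod_mul_distrib]
    rw [mul_assoc, Finset.sum_mul]
  rw [e]
  refine ⟨(integrable_finsetSum _ fun σ _ ↦ (key σ).1).const_mul _, ?_⟩
  rw [integral_const_mul, integral_finsetSum _ fun σ _ ↦ (key σ).1]
  have hσ : ∀ σ : Equiv.Perm (Fin n), ∫ y, ∏ e : Fin n × Fin n,
      ((if σ e.1 = e.2 then y e else 1) * (1 + (y e - 1) / n)) ∂(Measure.pi fun _ ↦ ν)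
        = (1 + v / n) ^ n := by
    intro σ
    rw [(key σ).2]
    have h1 : ∀ e : Fin n × Fin n, ((if σ e.1 = e.2 then (1 / n : ℝ) else 0) * (1 + v)
        + (if σ e.1 = e.2 then (1 - 1 / n : ℝ) else 1 / n)
        + (if σ e.1 = e.2 then 0 else (1 - 1 / n : ℝ)))
          = if σ e.1 = e.2 then (1 + v / n) else 1 := by
      intro e; split_ifs <;> ring
    rw [Finset.prod_congr rfl fun e _ ↦ h1 e, ← prod_perm_eq σ (fun _ ↦ 1 + v / n)]
    simp
  rw [Finset.sum_congr rfl fun σ _ ↦ hσ σ, Finset.sum_const, Finset.card_univ, Fintype.card_perm,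
    Fintype.card_fin, nsmul_eq_mul, inv_mul_cancel_left₀ (by positivity)]

include hL2 hmean hvar in
-- For a pair `σ, τ`, each entry used by both contributes `E Y² = 1 + v` and the rest contribute
-- one, so coincidences alone matter.
lemma integral_permMean_sq (n : ℕ) :
    Integrable (fun y ↦ permMean n y ^ 2) (Measure.pi fun _ ↦ ν) ∧
      ∫ y, permMean n y ^ 2 ∂(Measure.pi fun _ ↦ ν) ≤ Real.exp v := by
  have hv : 0 ≤ v := hvar ▸ integral_nonneg fun _ ↦ sq_nonneg _
  have key : ∀ σ τ : Equiv.Perm (Fin n), _ := fun σ τ ↦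
    integral_prod_quadratic (ι := Fin n × Fin n) hL2 hmean hvar
      (f := fun e x ↦ (if σ e.1 = e.2 then x else 1) * (if τ e.1 = e.2 then x else 1))
      (fun e ↦ if σ e.1 = e.2 then (if τ e.1 = e.2 then 1 else 0) else 0)
      (fun e ↦ if σ e.1 = e.2 then (if τ e.1 = e.2 then 0 else 1)
        else (if τ e.1 = e.2 then 1 else 0))
      (fun e ↦ if σ e.1 = e.2 then 0 else (if τ e.1 = e.2 then 0 else 1))
      (fun e x ↦ by split_ifs <;> ring)
  have e : (fun y ↦ permMean n y ^ 2) = fun y ↦ ((n.factorial : ℝ)⁻¹) ^ 2 *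
      ∑ σ : Equiv.Perm (Fin n), ∑ τ : Equiv.Perm (Fin n), ∏ e : Fin n × Fin n,
        ((if σ e.1 = e.2 then y e else 1) * (if τ e.1 = e.2 then y e else 1)) := by
    ext y
    simp only [permMean, prod_perm_eq, Finset.prod_mul_distrib]
    rw [mul_pow, sq (∑ σ : Equiv.Perm (Fin n), _), Finset.sum_mul_sum]
  rw [e]
  have hi : ∀ σ : Equiv.Perm (Fin n), Integrable (fun y : Fin n × Fin n → ℝ ↦
      ∑ τ : Equiv.Perm (Fin n), ∏ e : Fin n × Fin n,
        ((if σ e.1 = e.2 then y e else 1) * (if τ e.1 = e.2 then y e else 1)))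
      (Measure.pi fun _ ↦ ν) := fun σ ↦ integrable_finsetSum _ fun τ _ ↦ (key σ τ).1
  refine ⟨(integrable_finsetSum _ fun σ _ ↦ hi σ).const_mul _, ?_⟩
  have hστ : ∀ σ τ : Equiv.Perm (Fin n), ∫ y, ∏ e : Fin n × Fin n,
      ((if σ e.1 = e.2 then y e else 1) * (if τ e.1 = e.2 then y e else 1))
        ∂(Measure.pi fun _ ↦ ν) = ∏ i, (1 + if σ i = τ i then v else 0) := by
    intro σ τ
    rw [(key σ τ).2, Fintype.prod_prod_type]
    refine Finset.prod_congr rfl fun i _ ↦ ?_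
    rw [Finset.prod_eq_single (σ i)]
    · by_cases h : τ i = σ i
      · simp [h]
      · simp [h, Ne.symm h]
    · intro j _ hj
      simp only [Ne.symm hj, if_false]
      split_ifs <;> ring
    · simp
  rw [integral_const_mul, integral_finsetSum _ fun σ _ ↦ hi σ]
  have hs : ∀ σ : Equiv.Perm (Fin n), ∫ y, ∑ τ : Equiv.Perm (Fin n), ∏ e : Fin n × Fin n,
      ((if σ e.1 = e.2 then y e else 1) * (if τ e.1 = e.2 then y e else 1))
        ∂(Measure.pi fun _ ↦ ν)
        = ∑ τ : Equiv.Perm (Fin n), ∏ i, (1 + if σ i = τ i then v else 0) := by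
    intro σ
    rw [integral_finsetSum _ fun τ _ ↦ (key σ τ).1]
    exact Finset.sum_congr rfl fun τ _ ↦ hστ σ τ
  rw [Finset.sum_congr rfl fun σ _ ↦ hs σ, inv_pow, inv_mul_le_iff₀ (by positivity)]
  exact sum_perm_perm_prod_le n hv

include hL2 hmean hvar in
/-- The permanent and the product of all entries are close in `L²`. -/
lemma integral_permMean_sub_entryProd_sq (n : ℕ) :
    Integrable (fun y ↦ (permMean n y - entryProd n y) ^ 2) (Measure.pi fun _ ↦ ν) ∧
      ∫ y, (permMean n y - entryProd n y) ^ 2 ∂(Measure.pi fun _ ↦ ν)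
        ≤ 2 * Real.exp v - 2 * (1 + v / n) ^ n := by
  obtain ⟨a1, a2⟩ := integral_permMean_sq hL2 hmean hvar n
  obtain ⟨b1, b2⟩ := integral_permMean_mul_entryProd hL2 hmean hvar n
  obtain ⟨c1, c2⟩ := integral_entryProd_sq hL2 hmean hvar n
  have e : (fun y ↦ (permMean n y - entryProd n y) ^ 2)
      = fun y ↦ permMean n y ^ 2 - 2 * (permMean n y * entryProd n y) + entryProd n y ^ 2 := by
    ext; ring
  rw [e]
  refine ⟨(a1.sub (b1.const_mul 2)).add c1, ?_⟩
  rw [integral_add (f := fun y ↦ permMean n y ^ 2 - 2 * (permMean n y * entryProd n y))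
    (a1.sub (b1.const_mul 2)) c1, integral_sub a1 (b1.const_mul 2), integral_const_mul, b2]
  linarith

end Moments

/-! ### Convergence in distribution -/

/-- Slutsky's theorem for random variables on varying probability spaces whose difference tends to
zero in `L²`. -/
lemma tendstoInDistribution_of_integral_sub_sq {Ω : ℕ → Type*} [∀ n, MeasurableSpace (Ω n)]
    {P : ∀ n, Measure (Ω n)} [∀ n, IsProbabilityMeasure (P n)] {Ω' : Type*} [MeasurableSpace Ω']
    {P' : Measure Ω'} [IsProbabilityMeasure P'] {A B : ∀ n, Ω n → ℝ} {Z : Ω' → ℝ}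
    (hA : TendstoInDistribution A atTop Z P P') (hB : ∀ n, AEMeasurable (B n) (P n))
    (hint : ∀ᶠ n in atTop, Integrable (fun a ↦ (B n a - A n a) ^ 2) (P n))
    (h0 : Tendsto (fun n ↦ ∫ a, (B n a - A n a) ^ 2 ∂(P n)) atTop (𝓝 0)) :
    TendstoInDistribution B atTop Z P P' where
  forall_aemeasurable := hB
  aemeasurable_limit := hA.aemeasurable_limit
  tendsto := by
    have hAm := hA.forall_aemeasurable
    have hA' := ProbabilityMeasure.tendsto_iff_tendsto_charFun.1 hA.tendsto
    refine ProbabilityMeasure.tendsto_iff_tendsto_charFun.2 fun t ↦ ?_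
    refine tendsto_of_tendsto_of_dist (hA' t) ?_
    -- Since `exp (i t x)` is `|t|`-Lipschitz in `x`, the characteristic functions differ by at most
    -- `|t| E|B - A|`, which is bounded by the L² norm.
    have hs : Tendsto (fun n ↦ |t| * √(∫ a, (B n a - A n a) ^ 2 ∂(P n))) atTop (𝓝 0) := by
      simpa using (Real.continuous_sqrt.tendsto' 0 0 Real.sqrt_zero |>.comp h0).const_mul |t|
    refine squeeze_zero' (Eventually.of_forall fun _ ↦ dist_nonneg) ?_ hs
    filter_upwards [hint] with n hn
    simp only [ProbabilityMeasure.coe_mk, charFun_apply_real]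
    rw [integral_map (hAm n) (by fun_prop), integral_map (hB n) (by fun_prop), dist_eq_norm]
    have hI : ∀ {C : Ω n → ℝ}, AEMeasurable C (P n) →
        Integrable (fun a ↦ Complex.exp (t * C a * Complex.I)) (P n) := by
      intro C hC
      refine Integrable.of_bound (C := 1) (by fun_prop) (Eventually.of_forall fun a ↦ ?_)
      rw [← Complex.ofReal_mul, Complex.norm_exp_ofReal_mul_I]
    rw [← integral_sub (hI (hAm n)) (hI (hB n))]
    have hD : MemLp (fun a ↦ |B n a - A n a|) 2 (P n) := by
      rw [memLp_two_iff_integrable_sq (by fun_prop)]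
      simpa only [sq_abs] using hn
    have hle : ∫ a, |B n a - A n a| ∂(P n) ≤ √(∫ a, (B n a - A n a) ^ 2 ∂(P n)) := by
      apply Real.le_sqrt_of_sq_le
      have h := variance_nonneg (fun a ↦ |B n a - A n a|) (P n)
      rw [variance_eq_sub hD] at h
      simp only [Pi.pow_apply, sq_abs] at h
      linarith
    calc _ ≤ ∫ a, |t| * |B n a - A n a| ∂(P n) := by
          refine norm_integral_le_of_norm_le ((hD.integrable one_le_two).const_mul _)
            (Eventually.of_forall fun a ↦ ?_)
          have e : Complex.exp (t * A n a * Complex.I) - Complex.exp (t * B n a * Complex.I)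
              = Complex.exp ((t * B n a : ℝ) * Complex.I) *
                (Complex.exp (Complex.I * (t * (A n a - B n a) : ℝ)) - 1) := by
            rw [mul_sub, ← Complex.exp_add]
            push_cast
            ring_nf
          rw [e, norm_mul, Complex.norm_exp_ofReal_mul_I, one_mul]
          refine (Real.norm_exp_I_mul_ofReal_sub_one_le).trans ?_
          rw [Real.norm_eq_abs, abs_mul, abs_sub_comm]
      _ = |t| * ∫ a, |B n a - A n a| ∂(P n) := integral_const_mul _ _
      _ ≤ _ := by gcongr

/-- The log of `entryProd` is asymptotically Gaussian. -/
lemma tendstoInDistribution_sum_log {ν : Measure ℝ} [IsProbabilityMeasure ν]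
    (hnn : ∀ᵐ x ∂ν, 0 ≤ x) (hL2 : MemLp id 2 ν) (hmean : ∫ x, x ∂ν = 1) {v : ℝ≥0}
    (hvar : ∫ x, (x - 1) ^ 2 ∂ν = (v : ℝ)) {Ω : ℕ → Type*} [∀ n, MeasurableSpace (Ω n)]
    {P : ∀ n, Measure (Ω n)} [∀ n, IsProbabilityMeasure (P n)]
    {Y : ∀ n, Fin n × Fin n → Ω n → ℝ} (hlaw : ∀ n e, HasLaw (Y n e) ν (P n))
    (hindep : ∀ n, iIndepFun (Y n) (P n)) :
    TendstoInDistribution (fun n a ↦ ∑ e, Real.log (1 + (Y n e a - 1) / n)) atTop id P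
      (gaussianReal (-(v : ℝ) / 2) v) where
  forall_aemeasurable n := by
    have := fun e ↦ (hlaw n e).aemeasurable
    fun_prop
  tendsto := by
    refine ProbabilityMeasure.tendsto_iff_tendsto_charFun.2 fun t ↦ ?_
    simp only [ProbabilityMeasure.coe_mk, Measure.map_id, charFun_gaussianReal]
    refine (tendsto_one_add_pow_mul_self
      (tendsto_sq_mul_integral_sub_one hnn hL2 hmean hvar t)).congr fun n ↦ ?_
    have hm : Measurable fun x : ℝ ↦ Real.log (1 + (x - 1) / n) := by fun_prop
    have hi : iIndepFun (fun e a ↦ Real.log (1 + (Y n e a - 1) / n)) (P n) :=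
      (hindep n).comp (fun _ x ↦ Real.log (1 + (x - 1) / n)) fun _ ↦ hm
    have hc : charFun ((P n).map fun a ↦ ∑ e, Real.log (1 + (Y n e a - 1) / n))
        = ∏ e, charFun ((P n).map fun a ↦ Real.log (1 + (Y n e a - 1) / n)) :=
      hi.charFun_map_fun_sum_eq_prod fun e ↦ hm.comp_aemeasurable (hlaw n e).aemeasurable
    rw [hc, Finset.prod_apply]
    have he : ∀ e, charFun ((P n).map fun a ↦ Real.log (1 + (Y n e a - 1) / n)) t
        = ∫ x, Complex.exp ((t * Real.log (1 + (x - 1) / n) : ℝ) * Complex.I) ∂ν := by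
      intro e
      have hme : AEMeasurable (fun a ↦ Real.log (1 + (Y n e a - 1) / n)) (P n) :=
        hm.comp_aemeasurable (hlaw n e).aemeasurable
      rw [charFun_apply_real, integral_map hme (by fun_prop), ← (hlaw n e).map_eq, integral_map (hlaw n e).aemeasurable
          (Measurable.aestronglyMeasurable (by fun_prop))]
      simp
    rw [Finset.prod_congr rfl fun e _ ↦ he e, Finset.prod_const, Finset.card_univ,
      Fintype.card_prod, Fintype.card_fin]
    congr 1
    ring

/-- The normalised permanent of a random matrix with independent nonnegative entries of mean one is
asymptotically log-normal. -/
lemma tendstoInDistribution_permMean {ν : Measure ℝ} [IsProbabilityMeasure ν]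
    (hnn : ∀ᵐ x ∂ν, 0 ≤ x) (hL2 : MemLp id 2 ν) (hmean : ∫ x, x ∂ν = 1) {v : ℝ≥0}
    (hvar : ∫ x, (x - 1) ^ 2 ∂ν = (v : ℝ)) {Ω : ℕ → Type*} [∀ n, MeasurableSpace (Ω n)]
    {P : ∀ n, Measure (Ω n)} [∀ n, IsProbabilityMeasure (P n)]
    {Y : ∀ n, Fin n × Fin n → Ω n → ℝ} (hlaw : ∀ n e, HasLaw (Y n e) ν (P n))
    (hindep : ∀ n, iIndepFun (Y n) (P n)) :
    TendstoInDistribution (fun n a ↦ permMean n fun e ↦ Y n e a) atTop Real.exp P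
      (gaussianReal (-(v : ℝ) / 2) v) := by
  have hpi : ∀ n, HasLaw (fun a e ↦ Y n e a) (Measure.pi fun _ ↦ ν) (P n) :=
    fun n ↦ (hindep n).hasLaw_pi (hlaw n)
  have hsq : ∀ n, AEStronglyMeasurable (fun y ↦ (permMean n y - entryProd n y) ^ 2)
      ((P n).map fun a e ↦ Y n e a) := fun n ↦ by fun_prop
  -- `Real.exp (Real.log _)` recovers a factor only where it is positive; `n ≥ 2` and nonnegative
  -- entries ensure this.
  have hae : ∀ᶠ n in atTop, (fun a ↦ (permMean n (fun e ↦ Y n e a)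
      - Real.exp (∑ e, Real.log (1 + (Y n e a - 1) / n))) ^ 2)
      =ᵐ[P n] fun a ↦ (permMean n (fun e ↦ Y n e a) - entryProd n (fun e ↦ Y n e a)) ^ 2 := by
    filter_upwards [eventually_ge_atTop 2] with n hn
    have hpos : ∀ᵐ a ∂(P n), ∀ e, 0 ≤ Y n e a := by
      rw [ae_all_iff]
      intro e
      rw [← (hlaw n e).map_eq] at hnn
      exact ae_of_ae_map (hlaw n e).aemeasurable hnn
    filter_upwards [hpos] with a ha
    rw [Real.exp_sum, entryProd]
    congr 2
    refine Finset.prod_congr rfl fun e _ ↦ Real.exp_log ?_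
    have hn' : (2 : ℝ) ≤ n := by exact_mod_cast hn
    have : -(1 / 2) ≤ (Y n e a - 1) / n := by
      rw [le_div_iff₀ (by linarith)]; linarith [ha e]
    linarith
  have hbase := (tendstoInDistribution_sum_log hnn hL2 hmean hvar hlaw hindep).continuous_comp
    Real.continuous_exp
  refine tendstoInDistribution_of_integral_sub_sq hbase
    (fun n ↦ (measurable_permMean n).comp_aemeasurable (hpi n).aemeasurable) ?_ ?_
  · filter_upwards [hae] with n hn
    refine Integrable.congr ?_ hn.symm
    have h := (integral_permMean_sub_entryProd_sq hL2 hmean hvar n).1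
    rw [← (hpi n).map_eq] at h
    exact h.comp_aemeasurable (hpi n).aemeasurable
  · have hlim : Tendsto (fun n : ℕ ↦ 2 * Real.exp v - 2 * (1 + (v : ℝ) / n) ^ n) atTop (𝓝 0) := by
      simpa using ((Real.tendsto_one_add_div_pow_exp (v : ℝ)).const_mul 2).const_sub
        (2 * Real.exp v)
    refine squeeze_zero' (Eventually.of_forall fun n ↦ integral_nonneg fun _ ↦ sq_nonneg _) ?_ hlim
    filter_upwards [hae] with n hn
    refine le_trans (le_of_eq ?_) (integral_permMean_sub_entryProd_sq hL2 hmean hvar n).2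
    rw [← (hpi n).map_eq, integral_map (hpi n).aemeasurable (hsq n)]
    exact integral_congr_ae hn

/-! ### Perfect matchings as permutations -/

/-- The edge of `K_{n,n}` joining the `i`-th left vertex to the `j`-th right vertex. -/
def edgeOf {n : ℕ} (p : Fin n × Fin n) : Edge n :=
  ⟨s(Sum.inl p.1, Sum.inr p.2), by simp⟩

lemma edgeOf_bijective (n : ℕ) : Function.Bijective (edgeOf (n := n)) := by
  constructor
  · rintro ⟨i, j⟩ ⟨k, l⟩ h
    simpa [edgeOf] using h
  · rintro ⟨e, he⟩
    induction e using Sym2.ind with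
    | _ a b =>
      rcases a with i | i <;> rcases b with j | j
      · simp at he
      · exact ⟨(i, j), rfl⟩
      · exact ⟨(j, i), Subtype.ext Sym2.eq_swap⟩
      · simp at he

/-- The perfect matching of `K_{n,n}` given by the graph of a permutation. -/
def matchingOf {n : ℕ} (σ : Equiv.Perm (Fin n)) : PerfectMatching n :=
  ⟨{ verts := Set.univ
     Adj := fun a b ↦ (∃ i, a = Sum.inl i ∧ b = Sum.inr (σ i)) ∨
        ∃ i, b = Sum.inl i ∧ a = Sum.inr (σ i)
     adj_sub := by
      rintro a b (⟨i, rfl, rfl⟩ | ⟨i, rfl, rfl⟩) <;> simp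
     edge_vert := fun _ ↦ Set.mem_univ _
     symm := ⟨fun _ _ h ↦ h.symm⟩ }, by
    rw [SimpleGraph.Subgraph.isPerfectMatching_iff]
    rintro (i | j)
    · exact ⟨Sum.inr (σ i), by simp, by rintro b hb; simpa using hb⟩
    · refine ⟨Sum.inl (σ.symm j), by simp, ?_⟩
      rintro b hb
      obtain ⟨i, rfl, rfl⟩ : ∃ i, b = Sum.inl i ∧ j = σ i := by simpa using hb
      simp⟩

lemma edgeOf_mem_matchingOf {n : ℕ} (σ : Equiv.Perm (Fin n)) (p : Fin n × Fin n) :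
    (edgeOf p).1 ∈ (matchingOf σ).1.edgeSet ↔ σ p.1 = p.2 := by
  simp [edgeOf, matchingOf, SimpleGraph.Subgraph.mem_edgeSet, eq_comm]

/-- Each left vertex has a unique right partner; uniqueness at right vertices makes this map
injective, hence a permutation by finiteness. -/
lemma matchingOf_bijective (n : ℕ) : Function.Bijective (matchingOf (n := n)) := by
  constructor
  · intro σ τ h
    ext i : 1
    have h1 := (edgeOf_mem_matchingOf σ (i, σ i)).2 rfl
    rw [h, edgeOf_mem_matchingOf] at h1
    exact h1.symm
  · rintro ⟨M, hM⟩
    have hM' := SimpleGraph.Subgraph.isPerfectMatching_iff.1 hM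
    have hl : ∀ i : Fin n, ∃ j : Fin n, M.Adj (Sum.inl i) (Sum.inr j) := by
      intro i
      obtain ⟨b, hb, -⟩ := hM' (Sum.inl i)
      rcases b with k | k
      · exact absurd (M.adj_sub hb) (by simp)
      · exact ⟨k, hb⟩
    choose f hf using hl
    have hinj : Function.Injective f := by
      intro i k hik
      have h1 := (hf i).symm
      rw [hik] at h1
      exact Sum.inl_injective ((hM' (Sum.inr (f k))).unique h1 (hf k).symm)
    have hlr : ∀ i j, M.Adj (Sum.inl i) (Sum.inr j) ↔ f i = j := fun i j ↦
      ⟨fun h ↦ Sum.inr_injective ((hM' (Sum.inl i)).unique (hf i) h), fun h ↦ h ▸ hf i⟩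
    refine ⟨Equiv.ofBijective f (Finite.injective_iff_bijective.1 hinj), Subtype.ext ?_⟩
    refine SimpleGraph.Subgraph.ext ?_ ?_
    · exact (SimpleGraph.Subgraph.isSpanning_iff.1 hM.2).symm
    · ext a b
      rcases a with i | i <;> rcases b with j | j
      · simpa [matchingOf] using fun h ↦ absurd (M.adj_sub h) (by simp)
      · simp [matchingOf, hlr, eq_comm]
      · rw [M.adj_comm, hlr]
        simp [matchingOf, eq_comm]
      · simpa [matchingOf] using fun h ↦ absurd (M.adj_sub h) (by simp)

lemma weight_matchingOf {n : ℕ} (w : Edge n → EReal) (σ : Equiv.Perm (Fin n)) :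
    weight w (matchingOf σ) = ∑ i, w (edgeOf (i, σ i)) := by
  classical
  rw [weight, ← (edgeOf_bijective n).sum_comp, Fintype.sum_prod_type]
  refine Finset.sum_congr rfl fun i _ ↦ ?_
  simp [edgeOf_mem_matchingOf]

lemma exp_sum_mul {ι : Type*} (s : Finset ι) (x : ι → EReal) (r : ℝ) (hx : ∀ i ∈ s, x i ≠ ⊥) :
    EReal.exp ((r : EReal) * ∑ i ∈ s, x i) = ∏ i ∈ s, EReal.exp ((r : EReal) * x i) := by
  classical
  simp only [mul_comm (r : EReal), EReal.exp_mul]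
  -- The induction also carries nonvanishing: for negative `r`, `(a * b) ^ r = a ^ r * b ^ r` fails
  -- at `0 * ∞`.
  have key : EReal.exp (∑ i ∈ s, x i) ≠ 0 ∧
      EReal.exp (∑ i ∈ s, x i) ^ r = ∏ i ∈ s, EReal.exp (x i) ^ r := by
    induction s using Finset.induction_on with
    | empty => simp
    | insert i s hi ih =>
      obtain ⟨h1, h2⟩ := ih fun j hj ↦ hx j (Finset.mem_insert_of_mem hj)
      have h3 : EReal.exp (x i) ≠ 0 := by
        simpa using hx i (Finset.mem_insert_self _ _)
      rw [Finset.sum_insert hi, Finset.prod_insert hi, EReal.exp_add,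
        ENNReal.mul_rpow_of_ne_zero h3 h1, h2]
      exact ⟨mul_ne_zero h3 h1, rfl⟩
  exact key.2

lemma partitionFunction_eq {n : ℕ} (β : ℝ) (w : Edge n → EReal) (hw : ∀ e, w e ≠ ⊥) :
    partitionFunction n β w = (n.factorial : ℝ≥0∞)⁻¹ *
      ∑ σ : Equiv.Perm (Fin n), ∏ i, EReal.exp (((-β : ℝ) : EReal) * w (edgeOf (i, σ i))) := by
  rw [partitionFunction, ← (matchingOf_bijective n).sum_comp]
  simp only [weight_matchingOf]
  congr 1
  exact Finset.sum_congr rfl fun σ _ ↦ exp_sum_mul _ _ _ fun i _ ↦ hw _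

/-! ### Normalised weights -/

/-- The expectation of `exp (-β ω)`. -/
def laplace (μ : Measure EReal) (β : ℝ) : ℝ≥0∞ := ∫⁻ x, EReal.exp (((-β : ℝ) : EReal) * x) ∂μ

/-- The weight `exp (-β x)`, normalised to have mean one. -/
def normWeight (μ : Measure EReal) (β : ℝ) (x : EReal) : ℝ≥0∞ :=
  EReal.exp (((-β : ℝ) : EReal) * x) * (laplace μ β)⁻¹

@[fun_prop]
lemma measurable_exp_mul (r : ℝ) : Measurable fun x : EReal ↦ EReal.exp ((r : EReal) * x) :=
  EReal.measurable_exp.comp (measurable_const.mul measurable_id)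

@[fun_prop]
lemma measurable_normWeight (μ : Measure EReal) (β : ℝ) : Measurable (normWeight μ β) :=
  (measurable_exp_mul _).mul_const _

lemma exp_neg_mul_bot {β : ℝ} (hβ : 0 < β) : EReal.exp (((-β : ℝ) : EReal) * ⊥) = ⊤ := by
  rw [EReal.coe_mul_bot_of_neg (by linarith), EReal.exp_top]

/-- For `β > 0`, `exp (-β x)` vanishes only at `x = ⊤`, so a zero integral would force all mass
there. -/
lemma laplace_ne_zero {μ : Measure EReal} [IsProbabilityMeasure μ] (hμ : μ {⊤} ≠ 1) (β : ℝ)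
    (hβ : 0 < β) : laplace μ β ≠ 0 := by
  intro h
  rw [laplace, lintegral_eq_zero_iff (measurable_exp_mul _)] at h
  apply hμ
  rw [prob_compl_eq_zero_iff (measurableSet_singleton _) |>.symm]
  refine measure_mono_null ?_ (ae_iff.1 h)
  intro x hx
  simp only [Set.mem_compl_iff, Set.mem_singleton_iff] at hx
  simp only [Set.mem_ofPred_eq, Pi.zero_apply]
  induction x with
  | bot => rw [exp_neg_mul_bot hβ]; simp
  | coe x =>
    rw [← EReal.coe_mul, EReal.exp_coe, ENNReal.ofReal_eq_zero]
    exact (Real.exp_pos _).not_ge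
  | top => exact absurd rfl hx

lemma vSq_eq (μ : Measure EReal) (β : ℝ) :
    vSq μ β = (∫⁻ x, normWeight μ β x ^ 2 ∂μ).toReal - 1 := by
  rw [vSq]
  congr 2
  refine lintegral_congr fun x ↦ ?_
  rw [normWeight, mul_pow, sub_eq_add_neg, EReal.exp_add, EReal.exp_neg,
    show (2 : EReal) = ((2 : ℕ) : EReal) from rfl, EReal.exp_nmul, psi, ENNReal.exp_log,
    ← EReal.exp_nmul, ENNReal.inv_pow]
  congr 2
  rw [← mul_assoc]
  congr 1
  rw [show ((2 : ℕ) : EReal) = ((2 : ℝ) : EReal) from rfl, ← EReal.coe_mul]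
  congr 1
  ring

lemma laplace_lt_top {μ : Measure EReal} {β : ℝ} (h : psi μ β < ⊤) : laplace μ β < ⊤ := by
  rw [psi] at h
  simpa [laplace] using h

lemma lintegral_normWeight {μ : Measure EReal} {β : ℝ} (h0 : laplace μ β ≠ 0)
    (h1 : laplace μ β ≠ ⊤) : ∫⁻ x, normWeight μ β x ∂μ = 1 := by
  simp only [normWeight]
  rw [lintegral_mul_const _ (measurable_exp_mul _)]
  exact ENNReal.mul_inv_cancel h0 h1

lemma lintegral_normWeight_sq_lt_top {μ : Measure EReal} {β : ℝ} (h0 : laplace μ β ≠ 0)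
    (h2 : laplace μ (2 * β) < ⊤) : ∫⁻ x, normWeight μ β x ^ 2 ∂μ < ⊤ := by
  have e : ∀ x, normWeight μ β x ^ 2
      = EReal.exp (((-(2 * β) : ℝ) : EReal) * x) * ((laplace μ β)⁻¹) ^ 2 := by
    intro x
    rw [normWeight, mul_pow, ← EReal.exp_nmul, ← mul_assoc]
    congr 3
    rw [show ((2 : ℕ) : EReal) = ((2 : ℝ) : EReal) from rfl, ← EReal.coe_mul]
    congr 1
    ring
  simp only [e]
  rw [lintegral_mul_const _ (measurable_exp_mul _)]
  exact ENNReal.mul_lt_top h2 (ENNReal.pow_lt_top (ENNReal.inv_lt_top.2 (pos_iff_ne_zero.2 h0)))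

/-- Subtracting `n ψ(β)` divides by the `n`-th power of `laplace μ β`, one factor for each edge of a
matching. Finite normalised weights exclude edges of weight `⊥`. -/
lemma log_partitionFunction_sub {μ : Measure EReal} {β : ℝ} (hβ : 0 < β) (h1 : laplace μ β ≠ ⊤)
    {n : ℕ} (w : Edge n → EReal) (hw : ∀ e, normWeight μ β (w e) < ⊤) :
    ENNReal.log (partitionFunction n β w) - (n : EReal) * psi μ β
      = ENNReal.log (ENNReal.ofReal
          (permMean n fun p ↦ (normWeight μ β (w (edgeOf p))).toReal)) := by
  have hbot : ∀ e, w e ≠ ⊥ := by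
    intro e he
    have := hw e
    rw [he, normWeight, exp_neg_mul_bot hβ, ENNReal.top_mul (ENNReal.inv_ne_zero.2 h1)] at this
    exact lt_irrefl _ this
  rw [partitionFunction_eq β w hbot]
  change _ - (n : EReal) * ENNReal.log (laplace μ β) = _
  rw [← ENNReal.log_pow, sub_eq_add_neg, ← ENNReal.log_inv, ← ENNReal.log_mul_add]
  congr 1
  rw [permMean, ENNReal.ofReal_mul (by positivity), ENNReal.ofReal_inv_of_pos (by positivity),
    ENNReal.ofReal_natCast, mul_assoc, Finset.sum_mul, ENNReal.ofReal_sum_of_nonneg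
      fun σ _ ↦ Finset.prod_nonneg fun i _ ↦ ENNReal.toReal_nonneg]
  congr 1
  refine Finset.sum_congr rfl fun σ _ ↦ ?_
  rw [ENNReal.ofReal_prod_of_nonneg fun i _ ↦ ENNReal.toReal_nonneg]
  rw [Finset.prod_congr rfl fun i _ ↦ ENNReal.ofReal_toReal (hw (edgeOf (i, σ i))).ne]
  simp only [normWeight]
  rw [Finset.prod_mul_distrib, Finset.prod_const, Finset.card_univ, Fintype.card_fin, ENNReal.inv_pow]

end MinMatching

end

open MinMatching in
theorem theorem1p1 (μ : Measure EReal) [IsProbabilityMeasure μ]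
    (hψ : ∀ γ : ℝ, 0 < γ → MinMatching.psi μ γ < ⊤) (hμ : μ {⊤} ≠ 1)
    {Ω : ℕ → Type*} [∀ n, MeasurableSpace (Ω n)]
    (P : ∀ n, Measure (Ω n)) [∀ n, IsProbabilityMeasure (P n)]
    (ω : ∀ n, MinMatching.Edge n → Ω n → EReal)
    (hlaw : ∀ n e, HasLaw (ω n e) μ (P n))
    (hindep : ∀ n, iIndepFun (ω n) (P n))
    (β : ℝ) (hβ : 0 < β) :
    ∃ v : ℝ≥0, (v : ℝ) = MinMatching.vSq μ β ∧
      TendstoInDistribution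
        (fun n a ↦ ENNReal.log (MinMatching.partitionFunction n β (fun e ↦ ω n e a))
          - (n : EReal) * MinMatching.psi μ β)
        atTop (fun x : ℝ ↦ (x : EReal)) P (gaussianReal (-(v : ℝ) / 2) v) := by
  have h0 := laplace_ne_zero hμ β hβ
  have h1 := laplace_lt_top (hψ β hβ)
  have hsq := lintegral_normWeight_sq_lt_top h0 (laplace_lt_top (hψ (2 * β) (by linarith)))
  have hone := lintegral_normWeight h0 h1.ne
  have hfin : ∀ᵐ x ∂μ, normWeight μ β x < ⊤ :=
    ae_lt_top (measurable_normWeight μ β) (by rw [hone]; exact ENNReal.one_ne_top)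
  set φ : EReal → ℝ := fun x ↦ (normWeight μ β x).toReal
  have hφm : Measurable φ := (measurable_normWeight μ β).ennreal_toReal
  have hφ1 : ∫ x, φ x ∂μ = 1 := by
    rw [integral_toReal (measurable_normWeight μ β).aemeasurable hfin, hone, ENNReal.toReal_one]
  have hφsq : ∀ x, φ x ^ 2 = (normWeight μ β x ^ 2).toReal := fun x ↦ (ENNReal.toReal_pow _ _).symm
  have hφ2 : ∫ x, φ x ^ 2 ∂μ = vSq μ β + 1 := by
    simp only [hφsq]
    rw [integral_toReal (by fun_prop), vSq_eq, sub_add_cancel]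
    filter_upwards [hfin] with x hx using ENNReal.pow_lt_top hx
  have hφL2 : MemLp φ 2 μ := by
    rw [memLp_two_iff_integrable_sq hφm.aestronglyMeasurable]
    simp only [hφsq]
    exact integrable_toReal_of_lintegral_ne_top (by fun_prop) hsq.ne
  have hφi : Integrable φ μ := hφL2.integrable one_le_two
  have hφv : ∫ x, (φ x - 1) ^ 2 ∂μ = vSq μ β := by
    have e : ∀ x, (φ x - 1) ^ 2 = φ x ^ 2 - (2 * φ x - 1) := fun x ↦ by ring
    simp only [e]
    rw [integral_sub (g := fun x ↦ 2 * φ x - 1) hφL2.integrable_sq ((hφi.const_mul 2).sub (integrable_const 1)),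
      integral_sub (hφi.const_mul 2) (integrable_const 1), integral_const_mul, hφ1, hφ2]
    simp
    ring
  have hnonneg : 0 ≤ vSq μ β := hφv ▸ integral_nonneg fun _ ↦ sq_nonneg _
  obtain ⟨v, hv⟩ : ∃ v : ℝ≥0, (v : ℝ) = vSq μ β := ⟨⟨vSq μ β, hnonneg⟩, rfl⟩
  refine ⟨v, hv, ?_⟩
  have : IsProbabilityMeasure (μ.map φ) := Measure.isProbabilityMeasure_map hφm.aemeasurable
  have hνlaw : HasLaw φ (μ.map φ) μ := ⟨hφm.aemeasurable, rfl⟩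
  have hconv := tendstoInDistribution_permMean (ν := μ.map φ) (v := v)
    (ae_map_iff hφm.aemeasurable (measurableSet_le measurable_const measurable_id) |>.2
      (Eventually.of_forall fun _ ↦ ENNReal.toReal_nonneg))
    ((memLp_map_measure_iff aestronglyMeasurable_id hφm.aemeasurable).2 hφL2)
    (by rw [integral_map hφm.aemeasurable (by fun_prop), hφ1])
    (by rw [integral_map hφm.aemeasurable (by fun_prop), hφv, hv])
    (Y := fun n p a ↦ φ (ω n (edgeOf p) a)) (fun n p ↦ hνlaw.comp (hlaw n (edgeOf p)))
    (fun n ↦ ((hindep n).precomp (edgeOf_bijective n).injective).comp (fun _ ↦ φ) fun _ ↦ hφm)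
  -- Continuity into `EReal` includes `r = 0`, sent to `⊥`, so a vanishing permanent needs no
  -- separate treatment.
  have hg : Continuous fun r : ℝ ↦ ENNReal.log (ENNReal.ofReal r) :=
    ENNReal.continuous_log.comp ENNReal.continuous_ofReal
  refine (hconv.continuous_comp hg).congr (fun n ↦ ?_) (Eventually.of_forall fun x ↦ ?_)
  · have hae : ∀ᵐ a ∂(P n), ∀ e, normWeight μ β (ω n e a) < ⊤ := by
      rw [ae_all_iff]
      intro e
      have h : ∀ᵐ x ∂((P n).map (ω n e)), normWeight μ β x < ⊤ := by rwa [(hlaw n e).map_eq]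
      exact ae_of_ae_map (hlaw n e).aemeasurable h
    filter_upwards [hae] with a ha
    exact (log_partitionFunction_sub hβ h1.ne _ ha).symm
  · simp only [Function.comp]
    rw [ENNReal.log_ofReal_of_pos (Real.exp_pos x), Real.log_exp]
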